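/- Let $k$ be a commutative ring, let $\mathcal C$ be a $k$-linear Grothendieck category that is locally finitely presented, and let $(\mathcal O(n))_{n\in\mathbb Z}$ be a collection of finitely presented objects of $\mathcal C$. Let $\mathfrak a$ be the $k$-linear category with object set $\mathbb Z$ and $$\mathfrak a(n,m)=\begin{cases}\mathcal C(\mathcal O(-n),\mathcal O(-m)) & \text{if } n\ge m,\\ 0 & \text{otherwise,}\end{cases}$$ with the composition of $\mathcal C$, and let $u:\mathfrak a\to\mathcal C$, $n\mapsto\mathcal O(-n)$, be the natural functor. Let $\mathsf{Mod}(\mathfrak a)$ be the category of $k$-linear functors $\mathfrak a^{\mathrm{op}}\to\mathsf{Mod}(k)$, and let $i:\mathcal C\to\mathsf{Mod}(\mathfrak a)$, $C\mapsto\mathcal C(u(-),C)$. For $n\ge m$ let $\mathfrak a(-,m)_{\ge n}\subseteq\mathfrak a(-,m)$ be the submodule that equals $\mathfrak a(l,m)$ at every $l\ge n$ and $0$ at every $l<n$. Let $\mathcal L_{\mathrm{tails}}$ be the covering system on $\mathfrak a$ in which a subfunctor $R\subseteq\mathfrak a(-,m)$ covers $m$ if and only if $\mathfrak a(-,m)_{\ge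 n}\subseteq R$ for some $n\ge m$. Let $\mathcal T_{\mathrm{tails}}$ be the smallest $k$-linear topology on $\mathfrak a$ containing $\mathcal L_{\mathrm{tails}}$ (a $k$-linear topology being a covering system that satisfies the identity, pullback and glueing axioms of a Grothendieck topology, with subfunctors taken in $\mathsf{Mod}(\mathfrak a)$). Let $\mathsf{Qmod}(\mathfrak a)=\mathsf{Sh}(\mathfrak a,\mathcal T_{\mathrm{tails}})\subseteq\mathsf{Mod}(\mathfrak a)$ be the full subcategory of sheaves, i.e. of those $M$ for which $\mathrm{Hom}(\mathfrak a(-,m),M)\to\mathrm{Hom}(R,M)$ is bijective for every $m$ and every $R\in\mathcal T_{\mathrm{tails}}(m)$. The sequence $(\mathcal O(n))_{n\in\mathbb Z}$ is called $\mathbb Z$-generating if $i$ factors through an equivalence $\mathcal C\cong\mathsf{Qmod}(\mathfrak a)$. Suppose that $\mathcal L_{\mathrm{tails}}=\mathcal T_{\mathrm{tails}}$ on $\mathfrak a$. Then $(\mathcal O(n))_{n\in\mathbb Z}$ is $\mathbb Z$-generating if and only if both of the following conditions hold. 1. $(\mathcal O(n))_{n\in\mathbb Z}$ is ample: for every finitely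 presented object $C\in\mathcal C$ there is an $n_0\in\mathbb Z$ such that for every $n\ge n_0$ there is an epimorphism $\bigoplus_i\mathcal O(-n_i)\to C$, from a set-indexed direct sum, with $n_i\ge n$ for every $i$. 2. $u$ is $\mathcal L_{\mathrm{tails}}$-projective: for every epimorphism $c:X\to Y$ in $\mathcal C$, the morphism $i(c)$ is an $\mathcal L_{\mathrm{tails}}$-epimorphism. That is, for every $m\in\mathbb Z$ and every $f:\mathcal O(-m)\to Y$ there is an $R\in\mathcal L_{\mathrm{tails}}(m)$ such that $f\circ u(g)$ factors through $c$ for every $g$ in $R$. Equivalently, for every such $c$ and $f$ there is an $n_0\ge m$ such that every composition $\mathcal O(-n)\to\mathcal O(-m)\xrightarrow{f}Y$ with $n\ge n_0$ factors through $c$. -/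

import Mathlib

open CategoryTheory

universe w v u u'

/-! ### Linear topologies and sheaves on a `k`-linear category -/

namespace LinTop

open Opposite

section General

variable (k : Type w) [CommRing k]
variable (a : Type u') [Category.{v} a] [Preadditive a] [Linear k a]

/-- The property of a presheaf of `k`-modules on `a` of being a `k`-linear functor. -/
def isLinear : ObjectProperty (aᵒᵖ ⥤ ModuleCat.{v} k) := fun M =>
  (∀ ⦃A B : a⦄ (f g : A ⟶ B), M.map (f + g).op = M.map f.op + M.map g.op) ∧
  (∀ ⦃A B : a⦄ (r : k) (f : A ⟶ B), M.map (r • f).op = r • M.map f.op)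

/-- The category `Mod(a)` of right `a`-modules: `k`-linear functors `aᵒᵖ ⥤ Mod(k)`. -/
abbrev RMod := (isLinear k a).FullSubcategory

variable {a}

/-- A subfunctor (submodule) of the representable right module `a(-, A)`. -/
@[ext]
structure SubRep (A : a) where
  /-- the value at `B`, a submodule of `a(B, A)` -/
  val : ∀ B : a, Submodule k (B ⟶ A)
  comp_mem : ∀ {B B' : a} (g : B' ⟶ B) {f : B ⟶ A}, f ∈ val B → g ≫ f ∈ val B'

namespace SubRep

variable {k}

/-- Inclusion of subfunctors. -/
instance (A : a) : LE (SubRep k A) := ⟨fun R S => ∀ B, R.val B ≤ S.val B⟩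

variable (k) in
/-- The representable functor `a(-, A)` as a subfunctor of itself. -/
def all (A : a) : SubRep k A where
  val _ := ⊤
  comp_mem _ _ _ := Submodule.mem_top

/-- The pullback `f⁻¹R` of `R ⊆ a(-, A)` along `f : B ⟶ A`. -/
def pullback {A B : a} (f : B ⟶ A) (R : SubRep k A) : SubRep k B where
  val D := (R.val D).comap (Linear.rightComp k D f)
  comp_mem g h hh := by
    simp only [Submodule.mem_comap, Linear.rightComp_apply] at hh ⊢
    rw [Category.assoc]
    exact R.comp_mem g hh

end SubRep

variable (a) in
/-- A covering system: for every object `A`, a collection of subfunctors of `a(-, A)`. -/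
abbrev CovSys := ∀ A : a, Set (SubRep k A)

variable {k}

/-- The `k`-linearized axioms for a Grothendieck topology. -/
structure IsTopology (T : CovSys k a) : Prop where
  identity : ∀ A : a, SubRep.all k A ∈ T A
  pullback : ∀ {A B : a} (f : B ⟶ A) (R : SubRep k A), R ∈ T A → R.pullback f ∈ T B
  glueing : ∀ {A : a} (S R : SubRep k A), S ∈ T A →
    (∀ {B : a} (f : B ⟶ A), f ∈ S.val B → R.pullback f ∈ T B) → R ∈ T A

/-- The smallest topology containing a covering system `L`: the intersection of all topologies
containing `L`. -/
def generated (L : CovSys k a) : CovSys k a := fun A =>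
  {R | ∀ T : CovSys k a, IsTopology T → (∀ B, L B ⊆ T B) → R ∈ T A}

/-- The sheaf property of a module `M` with respect to a covering system: for each covering `R` of
`A`, every module morphism `s : R ⟶ M` extends uniquely to a morphism `a(-, A) ⟶ M`, i.e. (by the
Yoneda lemma) is given by a unique `x ∈ M(A)`. -/
def isSheaf (T : CovSys k a) : ObjectProperty (RMod k a) := fun M =>
  ∀ (A : a) (R : SubRep k A), R ∈ T A →
    ∀ s : (∀ B : a, R.val B →ₗ[k] M.obj.obj (op B)),
      (∀ {B B' : a} (g : B' ⟶ B) (f : R.val B),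
        s B' ⟨g ≫ f.1, R.comp_mem g f.2⟩ = M.obj.map g.op (s B f)) →
      ∃! x : M.obj.obj (op A), ∀ (B : a) (f : R.val B), s B f = M.obj.map f.1.op x

/-- The category `Sh(a, T)` of `k`-linear sheaves. -/
abbrev Sh (T : CovSys k a) := (isSheaf T).FullSubcategory

/-- `T`-epimorphisms between modules. -/
def IsTEpi (T : CovSys k a) {M N : RMod k a} (φ : M ⟶ N) : Prop :=
  ∀ (A : a) (y : N.obj.obj (op A)), ∃ R ∈ T A, ∀ (B : a) (g : B ⟶ A), g ∈ R.val B →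
    ∃ x : M.obj.obj (op B), φ.hom.app (op B) x = N.obj.map g.op y

end General

section Functor

variable (k : Type w) [CommRing k]
variable {a : Type u'} [Category.{v} a] [Preadditive a] [Linear k a]
variable {C : Type u} [Category.{v} C] [Preadditive C] [Linear k C]
variable (F : a ⥤ C) [F.Additive] [Functor.Linear k F]

/-- The functor `i : C ⥤ Mod(a)`, `X ↦ C(F(-), X)`, induced by a `k`-linear functor `F : a ⥤ C`. -/
def induced : C ⥤ RMod k a :=
  (isLinear k a).lift
    (linearYoneda k C ⋙ (Functor.whiskeringLeft aᵒᵖ Cᵒᵖ (ModuleCat.{v} k)).obj F.op) (by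
      intro X
      constructor
      · intro A B f g
        ext x
        exact (congrArg (· ≫ (show F.obj B ⟶ X from x)) F.map_add).trans
          (Preadditive.add_comp _ _ _ _ _ _)
      · intro A B r f
        ext x
        exact (congrArg (· ≫ (show F.obj B ⟶ X from x)) (F.map_smul r f)).trans
          (Linear.smul_comp _ _ _ _ _ _))

variable {k}

/-- `F` is `T`-projective: `i(c)` is a `T`-epimorphism for every epimorphism `c` of `C`. -/
def IsTProjective (T : CovSys k a) : Prop :=
  ∀ ⦃X Y : C⦄ (c : X ⟶ Y), Epi c → IsTEpi T ((induced k F).map c)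

/-- `F` induces an equivalence `C ≌ Sh(a, T)`: the functor `i` takes values in `T`-sheaves and its
corestriction `C ⥤ Sh(a, T)` is an equivalence of categories. -/
def InducesEquivSh (T : CovSys k a) : Prop :=
  ∃ h : ∀ X : C, isSheaf T ((induced k F).obj X),
    ((isSheaf T).lift (induced k F) h).IsEquivalence

end Functor

end LinTop

/-! ### The `ℤ`-algebra of a sequence of objects -/

/-- The objects of the (`k`-linear) `ℤ`-algebra associated with a sequence `(O n)` of objects: the
integers. -/
@[ext, nolint unusedArguments]
structure ZAlg (k : Type w) {C : Type u} (O : ℤ → C) : Type where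
  /-- the integer labelling an object -/
  deg : ℤ

section

variable (k : Type w) [CommRing k]
variable {C : Type u} [Category.{v} C] [Preadditive C] [Linear k C]

namespace ZAlg

open LinTop

variable (O : ℤ → C)

/-- The module `a(n, m)`, which is `C(O(-n), O(-m))` if `n ≥ m` and `0` otherwise. -/
def homs (n m : ZAlg k O) : Submodule k (O (-n.deg) ⟶ O (-m.deg)) where
  carrier := {f | n.deg < m.deg → f = 0}
  zero_mem' := fun _ => rfl
  add_mem' := fun hf hg h => by rw [hf h, hg h, add_zero]
  smul_mem' := fun r f hf h => by rw [hf h, smul_zero]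

variable {k O}

instance : Category.{v} (ZAlg k O) where
  Hom n m := homs k O n m
  id n := ⟨𝟙 _, fun h => absurd h (lt_irrefl _)⟩
  comp {n m l} f g := ⟨f.1 ≫ g.1, fun h => by
    rcases lt_or_ge n.deg m.deg with h' | h'
    · rw [f.2 h', Limits.zero_comp]
    · rw [g.2 (lt_of_le_of_lt h' h), Limits.comp_zero]⟩
  id_comp f := Subtype.ext (Category.id_comp _)
  comp_id f := Subtype.ext (Category.comp_id _)
  assoc f g h := Subtype.ext (Category.assoc _ _ _)

instance : Preadditive (ZAlg k O) where
  homGroup n m := inferInstanceAs (AddCommGroup (homs k O n m))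
  add_comp _ _ _ _ _ _ := Subtype.ext (Preadditive.add_comp _ _ _ _ _ _)
  comp_add _ _ _ _ _ _ := Subtype.ext (Preadditive.comp_add _ _ _ _ _ _)

instance : Linear k (ZAlg k O) where
  homModule n m := inferInstanceAs (Module k (homs k O n m))
  smul_comp _ _ _ _ _ _ := Subtype.ext (Linear.smul_comp _ _ _ _ _ _)
  comp_smul _ _ _ _ _ _ := Subtype.ext (Linear.comp_smul _ _ _ _ _ _)

variable (k O)

/-- The natural functor `u : a ⥤ C`, `n ↦ O(-n)`. -/
def toCat : ZAlg k O ⥤ C where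
  obj n := O (-n.deg)
  map f := f.1
  map_id _ := rfl
  map_comp _ _ := rfl

instance : (toCat k O).Additive where
  map_add := rfl

instance : Functor.Linear k (toCat k O) where
  map_smul _ _ := rfl

variable {k O}

/-- The truncation `a(-, m)_{≥ n}` of the representable module `a(-, m)`: it agrees with `a(-, m)` in
degrees `l ≥ n` and is `0` in the other degrees. -/
def tail (m : ZAlg k O) (n : ℤ) : SubRep k m where
  val l :=
    { carrier := {f | l.deg < n → f = 0}
      zero_mem' := fun _ => rfl
      add_mem' := fun hf hg h => by rw [hf h, hg h, add_zero]
      smul_mem' := fun r f hf h => by rw [hf h, smul_zero] }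
  comp_mem {l l'} g f hf h := by
    rcases lt_or_ge l.deg n with h' | h'
    · rw [hf h', Limits.comp_zero]
    · have hg : g = 0 := Subtype.ext (g.2 (lt_of_lt_of_le h h'))
      rw [hg, Limits.zero_comp]

variable (k O)

/-- The covering system `L_tails`. -/
def Ltails : CovSys k (ZAlg k O) := fun m => {R | ∃ n : ℤ, m.deg ≤ n ∧ tail m n ≤ R}

/-- The tails topology: the smallest topology containing `L_tails`. -/
def Ttails : CovSys k (ZAlg k O) := generated (Ltails k O)

/-- The category of quasi-coherent modules over the `ℤ`-algebra. -/
abbrev Qmod := Sh (Ttails k O)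

/-- `(O n)` is a `ℤ`-generating sequence: `u` induces an equivalence between `C` and the category
`Qmod k O` of quasi-coherent modules. -/
def IsZGenerating : Prop := InducesEquivSh (toCat k O) (Ttails k O)

end ZAlg

end

/-- `(O n)` is ample: for every finitely presented `X` there is an `n₀` such that for every `n ≥ n₀`
there is an epimorphism onto `X` from a (small) direct sum of objects `O(-nᵢ)` with all `nᵢ ≥ n`. -/
def IsAmpleSeq {C : Type u} [Category.{v} C] [Limits.HasCoproducts.{v} C] (O : ℤ → C) : Prop :=
  ∀ X : C, IsFinitelyPresentable.{v} X → ∃ n₀ : ℤ, ∀ n : ℤ, n₀ ≤ n →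
    ∃ (ι : Type v) (d : ι → ℤ) (p : (∐ fun i => O (-d i)) ⟶ X), (∀ i, n ≤ d i) ∧ Epi p

/-! ### Linear topologies, sheaves and local images -/

namespace LinTop

open Opposite

section General

variable {k : Type w} [CommRing k]
variable {a : Type u'} [Category.{v} a] [Preadditive a] [Linear k a]

/-! Write i for the induced functor. Throughout, an injective and locally surjective morphism of
sheaves is bijective (`surjective_of_isTEpi`).

Necessity. For ampleness, let p be the map to X from the coproduct indexed by all O(-l) ⟶ X with l ≥
n. In degrees ≥ n every section of i(X) comes from the image of p, so i turns the inclusion of that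
image into an isomorphism, and p is epi. For projectivity, the sections of i(Y) lying locally in the
image of i(c) form a subsheaf; its inclusion is mono and epi, hence invertible because C is
balanced.

Sufficiency. A map from a finitely presentable object to a coproduct of objects O(-nⱼ) involves
finitely many summands, so after composition with maps from O(-l), l large, it becomes a finite
formal combination of morphisms of the ℤ-algebra (`exists_toSigma_eq`). With ampleness, maps out of
X are therefore determined by generators and relations inside the ℤ-algebra
(`IsAmpleSeq.exists_comp_eq`); hence i(X) is a sheaf and i is full. For a sheaf M, take all sections
as generators and all relations between them, and form the cokernel Q in C. Projectivity lifts
sections locally along the two epimorphisms of this presentation, onto Q and onto the image of the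
relations. Thus M ⟶ i(Q) is locally surjective and injective, and i is essentially surjective. -/

theorem isTopology_generated (L : CovSys k a) : IsTopology (generated L) where
  identity A _ hT _ := hT.identity A
  pullback f R hR T hT hL := hT.pullback f R (hR T hT hL)
  glueing S R hS h T hT hL := hT.glueing S R (hS T hT hL) fun f hf => h f hf T hT hL

namespace IsTopology

variable {T : CovSys k a} (hT : IsTopology T)
include hT

theorem mem_of_le {A : a} {R S : SubRep k A} (hR : R ∈ T A) (h : R ≤ S) : S ∈ T A := by
  refine hT.glueing R S hR fun {B} f hf => ?_
  have : S.pullback f = SubRep.all k B := by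
    ext D g
    exact ⟨fun _ => Submodule.mem_top, fun _ => S.comp_mem g (h B hf)⟩
  rw [this]
  exact hT.identity B

theorem exists_le_inf {A : a} {R S : SubRep k A} (hR : R ∈ T A) (hS : S ∈ T A) :
    ∃ U ∈ T A, U ≤ R ∧ U ≤ S := by
  let U : SubRep k A :=
    { val := fun B => R.val B ⊓ S.val B
      comp_mem := fun g _ hf => ⟨R.comp_mem g hf.1, S.comp_mem g hf.2⟩ }
  refine ⟨U, hT.glueing R U hR fun {B} f hf => ?_, fun _ _ h => h.1, fun _ _ h => h.2⟩
  have : U.pullback f = S.pullback f := by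
    ext D g
    exact ⟨fun h => h.2, fun h => ⟨R.comp_mem g hf, h⟩⟩
  rw [this]
  exact hT.pullback f S hS

end IsTopology

namespace RMod

variable (M : RMod k a)

theorem map_comp_apply {A B D : a} (g : D ⟶ B) (f : B ⟶ A) (x : M.obj.obj (op A)) :
    M.obj.map (g ≫ f).op x = M.obj.map g.op (M.obj.map f.op x) := by
  rw [op_comp, Functor.map_comp]
  rfl

theorem map_id_apply {A : a} (x : M.obj.obj (op A)) : M.obj.map (𝟙 A).op x = x := by
  rw [op_id, CategoryTheory.Functor.map_id]
  rfl

theorem map_add_apply {A B : a} (f g : B ⟶ A) (x : M.obj.obj (op A)) :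
    M.obj.map (f + g).op x = M.obj.map f.op x + M.obj.map g.op x := by
  rw [M.property.1]
  rfl

theorem map_smul_apply {A B : a} (r : k) (f : B ⟶ A) (x : M.obj.obj (op A)) :
    M.obj.map (r • f).op x = r • M.obj.map f.op x := by
  rw [M.property.2]
  rfl

theorem map_zero_apply {A B : a} (x : M.obj.obj (op A)) :
    M.obj.map (0 : B ⟶ A).op x = 0 := by
  have := map_add_apply M (0 : B ⟶ A) 0 x
  rwa [add_zero, left_eq_add] at this

theorem hom_naturality {M N : RMod k a} (φ : M ⟶ N) {A B : a} (g : B ⟶ A)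
    (x : M.obj.obj (op A)) :
    φ.hom.app (op B) (M.obj.map g.op x) = N.obj.map g.op (φ.hom.app (op A) x) :=
  ConcreteCategory.congr_hom (φ.hom.naturality g.op) x

end RMod

theorem isSheaf.ext {T : CovSys k a} {M : RMod k a} (hM : isSheaf T M) {A : a} {R : SubRep k A}
    (hR : R ∈ T A) {x y : M.obj.obj (op A)}
    (h : ∀ (B : a) (f : B ⟶ A), f ∈ R.val B → M.obj.map f.op x = M.obj.map f.op y) : x = y := by
  refine (hM A R hR (fun B =>
    { toFun := fun f => M.obj.map f.1.op x
      map_add' := fun f g => RMod.map_add_apply M f.1 g.1 x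
      map_smul' := fun r f => RMod.map_smul_apply M r f.1 x })
    (fun g f => RMod.map_comp_apply M g f.1 x)).unique (fun _ _ => rfl) fun B f => h B f.1 f.2

/-- A locally surjective monomorphism of sheaves is surjective. -/
theorem surjective_of_isTEpi {T : CovSys k a} {M N : RMod k a} (hM : isSheaf T M)
    (hN : isSheaf T N) (φ : M ⟶ N)
    (hinj : ∀ A, Function.Injective (φ.hom.app (op A))) (hφ : IsTEpi T φ) (A : a) :
    Function.Surjective (φ.hom.app (op A)) := by
  intro y
  obtain ⟨R, hR, h⟩ := hφ A y
  -- Injectivity makes the local preimages unique, hence linear and compatible, so they glue in `M`.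
  choose s hs using h
  obtain ⟨x, hx, -⟩ := hM A R hR (fun B =>
    { toFun := fun f => s B f.1 f.2
      map_add' := fun f g => hinj B (by
        rw [map_add, hs, hs, hs]
        exact RMod.map_add_apply N f.1 g.1 y)
      map_smul' := fun r f => hinj B (by
        rw [RingHom.id_apply, map_smul, hs, hs]
        exact RMod.map_smul_apply N r f.1 y) })
    (fun {B B'} g f => hinj B' (by
      rw [RMod.hom_naturality]
      change φ.hom.app (op B') (s B' (g ≫ f.1) _) = N.obj.map g.op (φ.hom.app (op B) (s B f.1 f.2))
      rw [hs, hs, RMod.map_comp_apply]))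
  refine ⟨x, hN.ext hR fun B f hf => ?_⟩
  rw [← RMod.hom_naturality, ← hx B ⟨f, hf⟩]
  exact hs B f hf

theorem Sh.isIso_of_bijective {T : CovSys k a} {M N : Sh T} (φ : M ⟶ N)
    (h : ∀ A, Function.Bijective (φ.hom.hom.app (op A))) : IsIso φ := by
  have (X : aᵒᵖ) : IsIso (φ.hom.hom.app X) :=
    (ConcreteCategory.isIso_iff_bijective _).2 (h X.unop)
  have : IsIso φ.hom.hom := NatIso.isIso_of_isIso_app _
  have : IsIso ((isLinear k a).ι.map φ.hom) := ‹IsIso φ.hom.hom›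
  have : IsIso ((isSheaf T).ι.map φ) := isIso_of_reflects_iso φ.hom (isLinear k a).ι
  exact isIso_of_reflects_iso φ (isSheaf T).ι

/-- The morphisms `g` along which `y` lies in the image of `φ`. -/
def liftSieve {M N : RMod k a} (φ : M ⟶ N) {A : a} (y : N.obj.obj (op A)) : SubRep k A where
  val B :=
    { carrier := {g | ∃ x, φ.hom.app (op B) x = N.obj.map g.op y}
      zero_mem' := ⟨0, by rw [map_zero, RMod.map_zero_apply]⟩
      add_mem' := by
        rintro f g ⟨x, hx⟩ ⟨x', hx'⟩
        exact ⟨x + x', by rw [map_add, hx, hx', RMod.map_add_apply]⟩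
      smul_mem' := by
        rintro r f ⟨x, hx⟩
        exact ⟨r • x, by rw [map_smul, hx, RMod.map_smul_apply]⟩ }
  comp_mem := by
    rintro B B' g f ⟨x, hx⟩
    exact ⟨M.obj.map g.op x, by rw [RMod.hom_naturality, hx, RMod.map_comp_apply]⟩

theorem liftSieve_map {M N : RMod k a} (φ : M ⟶ N) {A B : a} (f : B ⟶ A)
    (y : N.obj.obj (op A)) : liftSieve φ (N.obj.map f.op y) = (liftSieve φ y).pullback f := by
  ext D g
  change (∃ x, φ.hom.app (op D) x = _) ↔ (∃ x, φ.hom.app (op D) x = N.obj.map (g ≫ f).op y)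
  rw [RMod.map_comp_apply]

theorem IsTopology.isTEpi_iff {T : CovSys k a} (hT : IsTopology T) {M N : RMod k a} (φ : M ⟶ N) :
    IsTEpi T φ ↔ ∀ (A : a) (y : N.obj.obj (op A)), liftSieve φ y ∈ T A :=
  ⟨fun h A y => by
    obtain ⟨R, hR, hR'⟩ := h A y
    exact hT.mem_of_le hR hR', fun h A y => ⟨_, h A y, fun _ _ hg => hg⟩⟩

section LocalImage

variable {T : CovSys k a} (hT : IsTopology T) {M N : RMod k a} (φ : M ⟶ N)

/-- The values of the submodule of `N` of sections lying locally in the image of `φ`. -/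
def localImageSubmodule (A : a) : Submodule k (N.obj.obj (op A)) where
  carrier := {y | liftSieve φ y ∈ T A}
  zero_mem' := hT.mem_of_le (hT.identity A) fun B g _ => ⟨0, by rw [map_zero, map_zero]⟩
  add_mem' {y y'} hy hy' := by
    obtain ⟨U, hU, h, h'⟩ := hT.exists_le_inf hy hy'
    refine hT.mem_of_le hU fun B g hg => ?_
    obtain ⟨x, hx⟩ := h B hg
    obtain ⟨x', hx'⟩ := h' B hg
    exact ⟨x + x', by rw [map_add, hx, hx', map_add]⟩
  smul_mem' r y hy := hT.mem_of_le hy fun B g ⟨x, hx⟩ => ⟨r • x, by rw [map_smul, hx, map_smul]⟩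

/-- The submodule of `N` of sections lying locally in the image of `φ`. -/
def localImage : RMod k a where
  obj :=
    { obj := fun A => ModuleCat.of k (localImageSubmodule hT φ A.unop)
      map := fun {A B} f => ModuleCat.ofHom ((N.obj.map f).hom.restrict
        (p := localImageSubmodule hT φ A.unop) (q := localImageSubmodule hT φ B.unop) (by
          intro y hy
          have := hT.pullback f.unop _ hy
          rwa [← liftSieve_map] at this))
      map_id := fun A => by
        ext y
        exact RMod.map_id_apply N y.1
      map_comp := fun f g => by
        ext y
        exact RMod.map_comp_apply N g.unop f.unop y.1 }
  property := by
    constructor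
    · intro A B f g
      ext y
      exact RMod.map_add_apply N f g y.1
    · intro A B r f
      ext y
      exact RMod.map_smul_apply N r f y.1

/-- The inclusion of the local image. -/
def localImageι : localImage hT φ ⟶ N where
  hom := { app := fun A => ModuleCat.ofHom (localImageSubmodule hT φ A.unop).subtype }

/-- The factorization of a morphism through its local image. -/
def toLocalImage : M ⟶ localImage hT φ where
  hom :=
    { app := fun A => ModuleCat.ofHom ((φ.hom.app A).hom.codRestrict _ fun x =>
        hT.mem_of_le (hT.identity A.unop) fun B g _ =>
          ⟨M.obj.map g.op x, RMod.hom_naturality φ g x⟩)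
      naturality := fun A B f => by
        ext x
        exact Subtype.ext (RMod.hom_naturality φ f.unop x) }

theorem localImageι_injective (A : a) :
    Function.Injective ((localImageι hT φ).hom.app (op A)) :=
  Subtype.val_injective

/-- The amalgamation exists in `N`; it is locally a section that is itself locally in the image, so
the glueing axiom puts it in the local image. -/
theorem isSheaf_localImage (hN : isSheaf T N) : isSheaf T (localImage hT φ) := by
  intro A R hR s hs
  obtain ⟨x, hx, hx'⟩ := hN A R hR
    (fun B => ((localImageι hT φ).hom.app (op B)).hom ∘ₗ s B) (fun {B B'} g f => by
      change (localImageι hT φ).hom.app (op B') (s B' _) = _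
      rw [hs, RMod.hom_naturality]
      rfl)
  have hmem : liftSieve φ x ∈ T A := by
    refine hT.glueing R _ hR fun {B} f hf => ?_
    rw [← liftSieve_map, ← hx B ⟨f, hf⟩]
    exact (s B ⟨f, hf⟩).2
  refine ⟨(⟨x, hmem⟩ : localImageSubmodule hT φ A), fun B f => ?_, fun y hy => ?_⟩
  · exact localImageι_injective hT φ B (hx B f)
  · refine localImageι_injective hT φ A (hx' _ fun B f => ?_)
    exact congrArg ((localImageι hT φ).hom.app (op B)) (hy B f)

end LocalImage

end General

/-! ### Projectivity from an equivalence with sheaves -/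

section Functor

variable {k : Type w} [CommRing k]
variable {a : Type u'} [Category.{v} a] [Preadditive a] [Linear k a]
variable {C : Type u} [Category.{v} C] [Preadditive C] [Linear k C]
variable (F : a ⥤ C) [F.Additive] [Functor.Linear k F]

/-- The epimorphism `E.map c` factors through its local image `I`, a subsheaf, so `I ⟶ E.obj Y` is
mono and epi. Nothing about exactness of sheaves is needed: transported back to the balanced
category `C`, this inclusion is invertible, so every section of the target lies locally in the
image. -/
theorem InducesEquivSh.isTProjective [Balanced C] {T : CovSys k a} (hT : IsTopology T)
    (h : InducesEquivSh F T) : IsTProjective F T := by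
  obtain ⟨h, hE⟩ := h
  intro X Y c hc
  set E := (isSheaf T).lift (induced k F) h
  let I : Sh T := ⟨localImage hT ((induced k F).map c), isSheaf_localImage hT _ (h Y)⟩
  let p : E.obj X ⟶ I := ObjectProperty.homMk (toLocalImage hT ((induced k F).map c))
  let j : I ⟶ E.obj Y := ObjectProperty.homMk (localImageι hT ((induced k F).map c))
  have hpj : p ≫ j = E.map c := rfl
  have : Mono j := by
    constructor
    intro Z f g hfg
    ext A z
    refine localImageι_injective hT _ A.unop ?_
    exact congrArg (fun t : Z ⟶ E.obj Y => t.hom.hom.app A z) hfg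
  have : Epi j := by
    have : Epi (p ≫ j) := by
      rw [hpj]
      infer_instance
    exact epi_of_epi p j
  have : IsIso (E.inv.map j) := isIso_of_mono_of_epi _
  have hj : IsIso j := isIso_of_reflects_iso j E.inv
  rw [hT.isTEpi_iff]
  intro A y
  have hy := ConcreteCategory.congr_hom
    (congrArg (fun t : E.obj Y ⟶ E.obj Y => t.hom.hom.app (op A)) (IsIso.inv_hom_id j)) y
  have := ((inv j).hom.hom.app (op A) y).2
  have e : ((inv j).hom.hom.app (op A) y).1 = y := hy
  rw [← e]
  exact this

end Functor
end LinTop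

/-! ### Finitely presentable objects and ample sequences -/

section
open Limits

variable {C : Type u} [Category.{v} C]

/-- A morphism from a finitely presentable object to a coproduct is a finite sum of morphisms
to the summands. -/
theorem exists_eq_sum_sigma_ι [Preadditive C] [HasFiniteCoproducts C]
    [HasFilteredColimitsOfSize.{v, v} C] {J : Type v} (f : J → C) [HasCoproduct f]
    {G : C} (hG : IsFinitelyPresentable.{v} G) (z : G ⟶ ∐ f) :
    ∃ (S : Finset J) (t : ∀ j, G ⟶ f j), z = ∑ j ∈ S, t j ≫ Sigma.ι f j := by
  classical
  -- The coproduct is the filtered colimit of its finite subcoproducts, so `z` factors through one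
  -- of them.
  obtain ⟨S, q, rfl⟩ := IsFinitelyPresentable.exists_hom_of_isColimit
    (CoproductsFromFiniteFiltered.isColimitFiniteSubproductsCocone f) z
  let g : S → C := fun x => f x.1.as
  change G ⟶ ∐ g at q
  have hid : 𝟙 (∐ g) = ∑ x, Sigma.π g x ≫ Sigma.ι g x := by
    refine Sigma.hom_ext _ _ fun y => ?_
    rw [Preadditive.comp_sum, Finset.sum_eq_single y]
    · rw [Sigma.ι_π_eq_id_assoc, Category.comp_id]
    · intro x _ hx
      rw [Sigma.ι_π_of_ne_assoc g hx.symm, zero_comp]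
    · simp
  let t (j : J) : G ⟶ f j :=
    if hj : Discrete.mk j ∈ S then q ≫ Sigma.π g ⟨Discrete.mk j, hj⟩ else 0
  have ht (j : J) (hj : Discrete.mk j ∈ S) : t j = q ≫ Sigma.π g ⟨Discrete.mk j, hj⟩ := dif_pos hj
  refine ⟨S.map discreteEquiv.toEmbedding, t, ?_⟩
  rw [Finset.sum_map, ← Finset.sum_coe_sort]
  change q ≫ Sigma.desc (fun x : S => Sigma.ι f x.1.as) = _
  rw [← Category.id_comp (Sigma.desc _), hid, Preadditive.sum_comp, Preadditive.comp_sum]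
  refine Finset.sum_congr rfl fun x _ => ?_
  rw [Category.assoc, Sigma.ι_desc, ← Category.assoc]
  exact congrArg (· ≫ Sigma.ι f x.1.as) (ht x.1.as x.2).symm

/-- Finitely presentable objects separate morphisms, and each is covered by objects `O (-d)` with
`d` as large as required. The bound `N` may depend on `c`; this leaves room for bounds produced by
finite presentability. -/
theorem IsAmpleSeq.hom_ext [HasCoproducts.{v} C] [IsLocallyFinitelyPresentable.{v} C] {O : ℤ → C}
    (hA : IsAmpleSeq O) {X Y : C} {f g : X ⟶ Y}
    (h : ∀ G : C, IsFinitelyPresentable.{v} G → ∀ c : G ⟶ X, ∃ N : ℤ, ∀ l : ℤ, N ≤ l →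
      ∀ b : O (-l) ⟶ G, b ≫ c ≫ f = b ≫ c ≫ g) : f = g := by
  have := Cardinal.fact_isRegular_aleph0.{v}
  obtain ⟨P, _, hP⟩ := HasCardinalFilteredGenerator.exists_generator C Cardinal.aleph0.{v}
  refine hP.isStrongGenerator.isSeparating f g fun G hG c => ?_
  have hG := hP.le_isCardinalPresentable G hG
  obtain ⟨N, hN⟩ := h G hG c
  obtain ⟨n₀, hn₀⟩ := hA G hG
  obtain ⟨ι, d, p, hd, hp⟩ := hn₀ (max n₀ N) (le_max_left _ _)
  rw [← cancel_epi p]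
  refine Sigma.hom_ext _ _ fun i => ?_
  simpa using hN (d i) ((le_max_right _ _).trans (hd i)) (Sigma.ι (fun i => O (-d i)) i ≫ p)

end

/-! ### Ampleness, formal combinations, and full faithfulness -/

namespace ZAlg
open Limits Opposite LinTop

variable {k : Type w} [CommRing k]
variable {C : Type u} [Category.{v} C] [Abelian C] [Linear k C] {O : ℤ → C}

/-- The condition `m.deg ≤ n` may be dropped, since raising `n` only shrinks the tail. -/
theorem tail_mem_Ltails (m : ZAlg k O) (n : ℤ) : tail m n ∈ Ltails k O m :=
  ⟨max m.deg n, le_max_left _ _, fun _ _ hf h => hf (lt_of_lt_of_le h (le_max_right _ _))⟩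

/-- The morphism of `C` underlying a morphism of the `ℤ`-algebra. -/
def homVal {l m : ZAlg k O} : (l ⟶ m) →+ (O (-l.deg) ⟶ O (-m.deg)) :=
  (homs k O l m).subtype.toAddMonoidHom

theorem homVal_injective {l m : ZAlg k O} : Function.Injective (homVal (l := l) (m := m)) :=
  Subtype.val_injective

theorem homVal_id (l : ZAlg k O) : homVal (𝟙 l) = 𝟙 _ := rfl

theorem homVal_comp {l m n : ZAlg k O} (f : l ⟶ m) (g : m ⟶ n) :
    homVal (f ≫ g) = homVal f ≫ homVal g := rfl

theorem homVal_smul {l m : ZAlg k O} (r : k) (f : l ⟶ m) : homVal (r • f) = r • homVal f := rfl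

/-- A morphism `O(-l) ⟶ O(-m)` of `C` with `m ≤ l`, as a morphism of the `ℤ`-algebra. -/
def homOfLE {l m : ZAlg k O} (h : m.deg ≤ l.deg) (f : O (-l.deg) ⟶ O (-m.deg)) : l ⟶ m :=
  (⟨f, fun h' => absurd h' (not_lt.2 h)⟩ : homs k O l m)

theorem homVal_homOfLE {l m : ZAlg k O} (h : m.deg ≤ l.deg) (f : O (-l.deg) ⟶ O (-m.deg)) :
    homVal (homOfLE h f) = f := rfl

theorem mem_tail {l m : ZAlg k O} {n : ℤ} (h : n ≤ l.deg) (f : l ⟶ m) : f ∈ (tail m n).val l :=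
  fun h' => absurd h' (not_lt.2 h)

theorem eq_zero_of_mem_tail {l m : ZAlg k O} {n : ℤ} (h : l.deg < n) {f : l ⟶ m}
    (hf : f ∈ (tail m n).val l) : f = 0 := hf h

/-- The sections of the module induced by `X` are the morphisms to `X`. -/
def sections (X : C) (A : ZAlg k O) :
    ((induced k (toCat k O)).obj X).obj.obj (op A) ≃ₗ[k] (O (-A.deg) ⟶ X) :=
  LinearEquiv.refl k (O (-A.deg) ⟶ X)

theorem sections_map (X : C) {A B : ZAlg k O} (g : B ⟶ A)
    (x : ((induced k (toCat k O)).obj X).obj.obj (op A)) :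
    sections X B (((induced k (toCat k O)).obj X).obj.map g.op x) =
      homVal g ≫ sections X A x := rfl

theorem sections_induced_map {X Y : C} (c : X ⟶ Y) (A : ZAlg k O)
    (x : ((induced k (toCat k O)).obj X).obj.obj (op A)) :
    sections Y A (((induced k (toCat k O)).map c).hom.app (op A) x) = sections X A x ≫ c := rfl

theorem map_symm_sections {X : C} {A B : ZAlg k O} (g : B ⟶ A) (x : O (-A.deg) ⟶ X) :
    ((induced k (toCat k O)).obj X).obj.map g.op ((sections X A).symm x) =
      (sections X B).symm (homVal g ≫ x) := rfl

theorem induced_hom_ext {X Y : C}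
    {φ ψ : (induced k (toCat k O)).obj X ⟶ (induced k (toCat k O)).obj Y}
    (h : ∀ (A : ZAlg k O) (x : O (-A.deg) ⟶ X),
      sections Y A (φ.hom.app (op A) ((sections X A).symm x)) =
      sections Y A (ψ.hom.app (op A) ((sections X A).symm x))) : φ = ψ := by
  ext A x
  exact h A.unop x

theorem injective_induced_map {X Y : C} (c : X ⟶ Y) [Mono c] (A : ZAlg k O) :
    Function.Injective (((induced k (toCat k O)).map c).hom.app (op A)) := fun x y hxy => by
  apply (sections X A).injective
  rw [← cancel_mono c, ← sections_induced_map, hxy, sections_induced_map]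

/-- The image of the coproduct of all maps `O (-l) ⟶ X`, `n ≤ l`, contains every section of `X` in
degrees at least `n`, and sheaves do not see the lower degrees. The bound `0` is arbitrary: the
argument works for every `n`. -/
theorem IsZGenerating.isAmpleSeq [HasCoproducts.{v} C] (hT : Ltails k O = Ttails k O)
    (h : IsZGenerating k O) : IsAmpleSeq O := by
  unfold IsZGenerating at h
  rw [← hT] at h
  obtain ⟨h, hE⟩ := h
  set E := (isSheaf (Ltails k O)).lift (induced k (toCat k O)) h
  refine fun X _ => ⟨0, fun n _ => ?_⟩
  let p := Sigma.desc (f := fun j : Σ l : {l : ℤ // n ≤ l}, O (-l.1) ⟶ X => O (-j.1.1))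
    fun j => j.2
  refine ⟨_, _, p, fun j => j.1.2, ?_⟩
  have hepi : IsTEpi (Ltails k O) ((induced k (toCat k O)).map (image.ι p)) := by
    intro A y
    refine ⟨tail A n, tail_mem_Ltails A n, fun B g hg => ?_⟩
    rcases lt_or_ge B.deg n with hB | hB
    · rw [eq_zero_of_mem_tail hB hg]
      exact ⟨0, by rw [map_zero, RMod.map_zero_apply]⟩
    · refine ⟨(sections _ B).symm
        (Sigma.ι (fun j : Σ l : {l : ℤ // n ≤ l}, O (-l.1) ⟶ X => O (-j.1.1))
        ⟨⟨B.deg, hB⟩, homVal g ≫ sections X A y⟩ ≫ factorThruImage p), ?_⟩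
      apply (sections X B).injective
      rw [sections_induced_map, sections_map, LinearEquiv.apply_symm_apply, Category.assoc,
        image.fac]
      exact Sigma.ι_desc _ _
  have : IsIso (E.map (image.ι p)) := Sh.isIso_of_bijective _ fun A =>
    ⟨injective_induced_map _ A, surjective_of_isTEpi (h _) (h _) _
      (injective_induced_map _) hepi A⟩
  have : IsIso (image.ι p) := isIso_of_reflects_iso _ E
  rw [← image.fac p]
  infer_instance

section Combinations

open Classical in
/-- The morphism to a coproduct of objects `O(-nⱼ)` defined by finitely many morphisms
of the `ℤ`-algebra. -/
noncomputable def toSigma {J : Type v} (D : J → ZAlg k O)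
    [HasCoproduct fun j => O (-(D j).deg)] (l : ZAlg k O) :
    (Π₀ j, (l ⟶ D j)) →+ (O (-l.deg) ⟶ ∐ fun j => O (-(D j).deg)) :=
  DFinsupp.liftAddHom fun j =>
    (Preadditive.rightComp _ (Sigma.ι (fun j => O (-(D j).deg)) j)).comp homVal

variable {J : Type v} (D : J → ZAlg k O) [HasCoproduct fun j => O (-(D j).deg)]

theorem toSigma_single [inst : DecidableEq J] (l : ZAlg k O) (j : J) (f : l ⟶ D j) :
    toSigma D l (DFinsupp.single j f) = homVal f ≫ Sigma.ι (fun j => O (-(D j).deg)) j := by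
  obtain rfl : inst = fun a b => Classical.propDecidable (a = b) := Subsingleton.elim _ _
  classical exact DFinsupp.liftAddHom_apply_single _ _ _

theorem toSigma_π [DecidableEq J] (l : ZAlg k O) (f : Π₀ j, (l ⟶ D j)) (j : J) :
    toSigma D l f ≫ Sigma.π (fun j => O (-(D j).deg)) j = homVal (f j) := by
  induction f using DFinsupp.induction with
  | h0 => rw [map_zero, zero_comp, DFinsupp.zero_apply, map_zero]
  | ha i b f _ _ ih =>
    rw [map_add, Preadditive.add_comp, ih, DFinsupp.add_apply, map_add, toSigma_single,
      Category.assoc]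
    congr 1
    by_cases hij : i = j
    · subst hij
      rw [Sigma.ι_π_eq_id, DFinsupp.single_eq_same, Category.comp_id]
    · rw [Sigma.ι_π_of_ne _ hij, DFinsupp.single_eq_of_ne (Ne.symm hij), comp_zero, map_zero]

/-- Projections to the summands recover the coefficients, so an identity in `C` between combinations
can be read back in the ℤ-algebra. -/
theorem toSigma_injective (l : ZAlg k O) : Function.Injective (toSigma D l) := by
  classical
  intro f g hfg
  refine DFinsupp.ext fun j => homVal_injective ?_
  rw [← toSigma_π, ← toSigma_π, hfg]

theorem toSigma_single_desc [DecidableEq J] {l : ZAlg k O} (j : J) (f : l ⟶ D j) {X : C}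
    (x : ∀ j, O (-(D j).deg) ⟶ X) :
    toSigma D l (DFinsupp.single j f) ≫ Sigma.desc x = homVal f ≫ x j := by
  rw [toSigma_single, Category.assoc, Sigma.ι_desc]

/-- Only finitely many summands occur in `z`. Once `l` is at least all their degrees, the components
`O (-l) ⟶ O (-(D j).deg)` are morphisms of the ℤ-algebra; below that bound they need not be. -/
theorem exists_toSigma_eq [IsGrothendieckAbelian.{v} C] {G : C} (hG : IsFinitelyPresentable.{v} G)
    (z : G ⟶ ∐ fun j => O (-(D j).deg)) :
    ∃ N : ℤ, ∀ l : ZAlg k O, N ≤ l.deg → ∀ g : O (-l.deg) ⟶ G, ∃ t, toSigma D l t = g ≫ z := by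
  classical
  obtain ⟨S, t, rfl⟩ := exists_eq_sum_sigma_ι _ hG z
  obtain ⟨N, hN⟩ := (S.image fun j => (D j).deg).exists_le
  refine ⟨N, fun l hl g => ⟨∑ j ∈ S.attach, DFinsupp.single j.1
    (homOfLE ((hN _ (Finset.mem_image_of_mem _ j.2)).trans hl) (g ≫ t j.1)), ?_⟩⟩
  rw [map_sum, Preadditive.comp_sum, ← S.sum_attach]
  refine Finset.sum_congr rfl fun j _ => ?_
  rw [toSigma_single, homVal_homOfLE, Category.assoc]

end Combinations

theorem faithful_induced [HasCoproducts.{v} C] [IsLocallyFinitelyPresentable.{v} C]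
    (hA : IsAmpleSeq O) : (induced k (toCat k O)).Faithful where
  map_injective {X Y f g} hfg := hA.hom_ext fun G _ c => ⟨0, fun l _ b => by
    have := congrArg (fun φ : (induced k (toCat k O)).obj X ⟶ (induced k (toCat k O)).obj Y =>
      sections Y ⟨l⟩ (φ.hom.app (op ⟨l⟩) ((sections X ⟨l⟩).symm (b ≫ c)))) hfg
    simpa only [sections_induced_map, LinearEquiv.apply_symm_apply, Category.assoc] using this⟩

section Ample

variable [IsGrothendieckAbelian.{v} C] [IsLocallyFinitelyPresentable.{v} C]

/-- The map to `Y` descends to `X` if it kills the kernel of `Sigma.desc x`. By ampleness this can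
be tested on maps from `O (-l)`, `l` large, through finitely presentable objects, where elements of
the kernel become relations with coefficients in the ℤ-algebra. -/
theorem _root_.IsAmpleSeq.exists_comp_eq (hA : IsAmpleSeq O) {J : Type v} (D : J → ZAlg k O)
    {X Y : C} (x : ∀ j, O (-(D j).deg) ⟶ X) (y : ∀ j, O (-(D j).deg) ⟶ Y) [Epi (Sigma.desc x)]
    (h : ∀ l t, toSigma D l t ≫ Sigma.desc x = 0 → toSigma D l t ≫ Sigma.desc y = 0) :
    ∃ f : X ⟶ Y, ∀ j, x j ≫ f = y j := by
  have hq : kernel.ι (Sigma.desc x) ≫ Sigma.desc y = 0 := by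
    refine hA.hom_ext fun G hG c => ?_
    obtain ⟨N, hN⟩ := exists_toSigma_eq D hG (c ≫ kernel.ι (Sigma.desc x))
    refine ⟨N, fun l hl b => ?_⟩
    obtain ⟨t, ht⟩ := hN ⟨l⟩ hl b
    have := h ⟨l⟩ t (by simp [ht])
    simpa [ht] using this
  let hc := Abelian.epiIsCokernelOfKernel _ (kernelIsKernel (Sigma.desc x))
  refine ⟨hc.desc (CokernelCofork.ofπ (Sigma.desc y) hq), fun j => ?_⟩
  have hf := congrArg (Sigma.ι (fun j => O (-(D j).deg)) j ≫ ·)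
    (hc.fac (CokernelCofork.ofπ (Sigma.desc y) hq) WalkingParallelPair.one)
  simpa using hf

/-- Ampleness applied to `O (-m.deg)` makes the elements of `R` jointly epimorphic; this gives
uniqueness. Existence holds because `s`, being linear and natural, respects every relation between
elements of `R`. -/
theorem isSheaf_induced (hO : ∀ n : ℤ, IsFinitelyPresentable.{v} (O n)) (hA : IsAmpleSeq O)
    (X : C) : isSheaf (Ltails k O) ((induced k (toCat k O)).obj X) := by
  rintro m R ⟨n, hmn, hR⟩ s hs
  let D (j : Σ B : ZAlg k O, R.val B) : ZAlg k O := j.1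
  let x (j : Σ B : ZAlg k O, R.val B) : O (-(D j).deg) ⟶ O (-m.deg) := homVal j.2.1
  let y (j : Σ B : ZAlg k O, R.val B) : O (-(D j).deg) ⟶ X := sections X j.1 (s j.1 j.2)
  have hp : Epi (Sigma.desc x) := by
    obtain ⟨n₀, hn₀⟩ := hA _ (hO (-m.deg))
    obtain ⟨ι, d, p, hd, hp⟩ := hn₀ (max n₀ n) (le_max_left _ _)
    have hd' (i : ι) : n ≤ d i := (le_max_right _ _).trans (hd i)
    let g (i : ι) : (⟨d i⟩ : ZAlg k O) ⟶ m :=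
      homOfLE (hmn.trans (hd' i)) (Sigma.ι (fun i => O (-d i)) i ≫ p)
    have hg (i : ι) : g i ∈ R.val ⟨d i⟩ := hR _ (mem_tail (hd' i) _)
    refine epi_of_epi_fac (f := Sigma.desc fun i =>
      Sigma.ι (fun j => O (-(D j).deg)) ⟨⟨d i⟩, g i, hg i⟩) (h := p) ?_
    refine Sigma.hom_ext _ _ fun i => ?_
    rw [Sigma.ι_desc_assoc, Sigma.ι_desc]
    rfl
  -- Since `R` is a submodule, a combination of its elements is a single element `b` of `R`, and `s`
  -- sends it to the same combination of values.
  have key (l : ZAlg k O) (t : Π₀ j, (l ⟶ D j)) : ∃ b : R.val l,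
      toSigma D l t ≫ Sigma.desc x = homVal b.1 ∧
        toSigma D l t ≫ Sigma.desc y = sections X l (s l b) := by
    classical
    induction t using DFinsupp.induction with
    | h0 => exact ⟨0, by simp, by rw [map_zero, map_zero, zero_comp, map_zero]⟩
    | ha j f t _ _ ih =>
      obtain ⟨b, hb, hb'⟩ := ih
      refine ⟨⟨f ≫ j.2.1, R.comp_mem f j.2.2⟩ + b, ?_, ?_⟩
      · rw [map_add, Preadditive.add_comp, hb, toSigma_single_desc]
        rfl
      · rw [map_add, map_add, map_add, hs, Preadditive.add_comp, hb', toSigma_single_desc,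
          sections_map]
  obtain ⟨f, hf⟩ := hA.exists_comp_eq D x y fun l t ht => by
    obtain ⟨b, hb, hb'⟩ := key l t
    rw [ht] at hb
    have : b = 0 := Subtype.ext (homVal_injective (by rw [← hb]; exact (map_zero _).symm))
    rw [hb', this, map_zero, map_zero]
  refine ⟨(sections X m).symm f, fun B g => ?_, fun y hy => ?_⟩
  · rw [map_symm_sections, LinearEquiv.eq_symm_apply]
    exact (hf ⟨B, g⟩).symm
  · rw [LinearEquiv.eq_symm_apply, ← cancel_epi (Sigma.desc x)]
    refine Sigma.hom_ext _ _ fun j => ?_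
    rw [Sigma.ι_desc_assoc, Sigma.ι_desc_assoc, hf, ← sections_map, ← hy]

/-- `X` is generated by all maps `O (-l) ⟶ X`, and `φ` respects their relations because it is
additive and natural. -/
theorem full_induced (hA : IsAmpleSeq O) : (induced k (toCat k O)).Full where
  map_surjective {X Y} φ := by
    let D (j : Σ B : ZAlg k O, O (-B.deg) ⟶ X) : ZAlg k O := j.1
    let x (j : Σ B : ZAlg k O, O (-B.deg) ⟶ X) : O (-(D j).deg) ⟶ X := j.2
    let φ' (l : ZAlg k O) (b : O (-l.deg) ⟶ X) : O (-l.deg) ⟶ Y :=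
      sections Y l (φ.hom.app (op l) ((sections X l).symm b))
    have hφ₀ (l : ZAlg k O) : φ' l 0 = 0 := by simp only [φ', map_zero]
    have hφ (l : ZAlg k O) (b b') : φ' l (b + b') = φ' l b + φ' l b' := by
      simp only [φ', map_add]
    have hφ' {l m : ZAlg k O} (g : l ⟶ m) (b) : φ' l (homVal g ≫ b) = homVal g ≫ φ' m b := by
      simp only [φ', ← map_symm_sections, RMod.hom_naturality, sections_map]
    let y (j : Σ B : ZAlg k O, O (-B.deg) ⟶ X) : O (-(D j).deg) ⟶ Y := φ' j.1 j.2
    have hp : Epi (Sigma.desc x) := ⟨fun {Z} f g hfg => hA.hom_ext fun G _ c => ⟨0, fun l _ b => by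
      have := congrArg (Sigma.ι (fun j => O (-(D j).deg)) ⟨⟨l⟩, b ≫ c⟩ ≫ ·) hfg
      simp only [Sigma.ι_desc_assoc] at this
      simpa only [x, Category.assoc] using this⟩⟩
    have key (l : ZAlg k O) (t : Π₀ j, (l ⟶ D j)) :
        toSigma D l t ≫ Sigma.desc y = φ' l (toSigma D l t ≫ Sigma.desc x) := by
      classical
      induction t using DFinsupp.induction with
      | h0 => rw [map_zero, zero_comp, zero_comp, hφ₀]
      | ha j f t _ _ ih =>
        rw [map_add, Preadditive.add_comp, Preadditive.add_comp, ih, hφ, toSigma_single_desc,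
          toSigma_single_desc, hφ']
    obtain ⟨f, hf⟩ := hA.exists_comp_eq D x y fun l t ht => by rw [key, ht, hφ₀]
    refine ⟨f, induced_hom_ext fun A b => ?_⟩
    rw [sections_induced_map, LinearEquiv.apply_symm_apply]
    exact hf ⟨A, b⟩

end Ample

end ZAlg

/-! ### Presentations of modules and essential surjectivity -/

namespace ZAlg
open Limits Opposite LinTop

variable {k : Type w} [CommRing k]
variable {C : Type u} [Category.{v} C] [Abelian C] [Linear k C] {O : ℤ → C}

section Presentation

variable (M : RMod k (ZAlg k O))

/-- The objects indexing the generators of `M`, one for each section of `M`. -/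
abbrev genObj (j : Σ A : ZAlg k O, M.obj.obj (op A)) : ZAlg k O := j.1

open Classical in
/-- The evaluation of formal combinations of sections of `M`. -/
noncomputable def evalComb (l : ZAlg k O) : (Π₀ j, (l ⟶ genObj M j)) →+ M.obj.obj (op l) :=
  DFinsupp.liftAddHom fun j =>
    { toFun := fun f => M.obj.map f.op j.2
      map_zero' := RMod.map_zero_apply M j.2
      map_add' := fun f g => RMod.map_add_apply M f g j.2 }

theorem evalComb_single [inst : DecidableEq (Σ A : ZAlg k O, M.obj.obj (op A))] (l : ZAlg k O)
    (j : Σ A : ZAlg k O, M.obj.obj (op A)) (f : l ⟶ genObj M j) :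
    evalComb M l (DFinsupp.single j f) = M.obj.map f.op j.2 := by
  obtain rfl : inst = fun a b => Classical.propDecidable (a = b) := Subsingleton.elim _ _
  exact @DFinsupp.liftAddHom_apply_single _ _ _ (fun a b => Classical.propDecidable (a = b))
    _ _ _ _ _

/-- The relations between the sections of `M`. -/
abbrev Relation := Σ l : ZAlg k O, (evalComb M l).ker

/-- The objects indexing the relations of `M`. -/
abbrev relObj (r : Relation M) : ZAlg k O := r.1

variable [HasCoproducts.{v} C]

/-- The morphism of coproducts given by the relations between the sections of `M`. -/
noncomputable def relations :
    (∐ fun r => O (-(relObj M r).deg)) ⟶ ∐ fun j => O (-(genObj M j).deg) :=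
  Sigma.desc fun r => toSigma (genObj M) r.1 r.2.1

/-- Relations form a submodule, so a combination of relations is again one. This is what lets a lift
through `relations M` certify that a section of `M` vanishes. -/
theorem exists_toSigma_comp_relations (l : ZAlg k O) (t : Π₀ r, (l ⟶ relObj M r)) :
    ∃ c, toSigma (relObj M) l t ≫ relations M = toSigma (genObj M) l c ∧ evalComb M l c = 0 := by
  classical
  have comp {l m : ZAlg k O} (g : l ⟶ m) (c : Π₀ j, (m ⟶ genObj M j)) :
      ∃ c', homVal g ≫ toSigma (genObj M) m c = toSigma (genObj M) l c' ∧
        evalComb M l c' = M.obj.map g.op (evalComb M m c) := by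
    induction c using DFinsupp.induction with
    | h0 => exact ⟨0, by simp, by simp⟩
    | ha j f c _ _ ih =>
      obtain ⟨c', h, h'⟩ := ih
      refine ⟨DFinsupp.single (β := fun j => (l ⟶ genObj M j)) j (g ≫ f) + c', ?_, ?_⟩
      · rw [map_add, map_add, Preadditive.comp_add, h, toSigma_single, toSigma_single,
          homVal_comp, Category.assoc]
      · rw [map_add, map_add, map_add, h', evalComb_single, evalComb_single,
          RMod.map_comp_apply]
  induction t using DFinsupp.induction with
  | h0 => exact ⟨0, by simp, by simp⟩
  | ha r f t _ _ ih =>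
    obtain ⟨c, h, h'⟩ := ih
    obtain ⟨c', h₁, h₁'⟩ := comp f r.2.1
    refine ⟨c' + c, ?_, ?_⟩
    · rw [map_add, map_add, Preadditive.add_comp, h, relations, toSigma_single_desc, ← h₁]
    · rw [map_add, h', h₁', (AddMonoidHom.mem_ker).1 r.2.2, map_zero, add_zero]

theorem toSigma_comp_π_eq_zero (l : ZAlg k O) (c : Π₀ j, (l ⟶ genObj M j))
    (hc : evalComb M l c = 0) :
    toSigma (genObj M) l c ≫ cokernel.π (relations M) = 0 := by
  have := congrArg (Sigma.ι (fun r => O (-(relObj M r).deg)) ⟨l, c, hc⟩ ≫ ·)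
    (cokernel.condition (relations M))
  simp only [relations, Sigma.ι_desc_assoc] at this
  exact this.trans comp_zero

/-- The morphism to the cokernel of the relations of `M` given by a section of `M`. -/
noncomputable def toCokernel {l : ZAlg k O} (x : M.obj.obj (op l)) :
    O (-l.deg) ⟶ cokernel (relations M) :=
  Sigma.ι (fun j => O (-(genObj M j).deg)) ⟨l, x⟩ ≫ cokernel.π (relations M)

/-- A combination differs from the single generator indexed by its value by a relation. Naturality
and additivity of `toCokernel` are the cases of one and two terms. -/
theorem toSigma_comp_π (l : ZAlg k O) (c : Π₀ j, (l ⟶ genObj M j)) :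
    toSigma (genObj M) l c ≫ cokernel.π (relations M) = toCokernel M (evalComb M l c) := by
  classical
  have := toSigma_comp_π_eq_zero M l (c - DFinsupp.single ⟨l, evalComb M l c⟩ (𝟙 l)) (by
    rw [map_sub, evalComb_single, RMod.map_id_apply, sub_self])
  rwa [map_sub, Preadditive.sub_comp, sub_eq_zero, toSigma_single, homVal_id,
    Category.id_comp] at this

open Classical in
theorem homVal_comp_toCokernel {l m : ZAlg k O} (f : l ⟶ m) (x : M.obj.obj (op m)) :
    homVal f ≫ toCokernel M x = toCokernel M (M.obj.map f.op x) := by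
  have := toSigma_comp_π M l (DFinsupp.single ⟨m, x⟩ f)
  rwa [toSigma_single, evalComb_single, Category.assoc] at this

open Classical in
theorem toCokernel_add {l : ZAlg k O} (x y : M.obj.obj (op l)) :
    toCokernel M (x + y) = toCokernel M x + toCokernel M y := by
  have := toSigma_comp_π M l (DFinsupp.single ⟨l, x⟩ (𝟙 l) + DFinsupp.single ⟨l, y⟩ (𝟙 l))
  rw [map_add, map_add, Preadditive.add_comp, toSigma_comp_π, toSigma_comp_π, evalComb_single,
    evalComb_single, RMod.map_id_apply, RMod.map_id_apply] at this
  exact this.symm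

theorem toCokernel_smul {l : ZAlg k O} (r : k) (x : M.obj.obj (op l)) :
    toCokernel M (r • x) = r • toCokernel M x := by
  -- Scalars act through the endomorphisms `r • 𝟙 l`, so linearity is a case of naturality.
  have := homVal_comp_toCokernel M (r • 𝟙 l) x
  rw [homVal_smul, homVal_id, Linear.smul_comp, Category.id_comp, RMod.map_smul_apply,
    RMod.map_id_apply] at this
  exact this.symm

/-- The canonical morphism from `M` to the module induced by the cokernel of its relations. -/
noncomputable def toInducedCokernel : M ⟶ (induced k (toCat k O)).obj (cokernel (relations M)) where
  hom :=
    { app := fun A => ModuleCat.ofHom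
        ((sections (cokernel (relations M)) A.unop).symm.toLinearMap ∘ₗ
          { toFun := fun x => toCokernel M (l := A.unop) x
            map_add' := fun x y => toCokernel_add M x y
            map_smul' := fun r x => toCokernel_smul M r x })
      naturality := fun A B f => by
        ext x
        exact (homVal_comp_toCokernel M f.unop x).symm }

theorem sections_toInducedCokernel (A : ZAlg k O) (x : M.obj.obj (op A)) :
    sections _ A ((toInducedCokernel M).hom.app (op A) x) = toCokernel M x := rfl

end Presentation

section

variable [IsGrothendieckAbelian.{v} C]

/-- If `x` dies in the cokernel, its generator lands in the image of `relations M`. Projectivity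
lifts it locally to the coproduct of relations, and in high degree the lift is a formal combination;
so `x` is locally zero, and `M` is separated. -/
theorem injective_toInducedCokernel (hO : ∀ n : ℤ, IsFinitelyPresentable.{v} (O n))
    (hP : IsTProjective (toCat k O) (Ltails k O)) {M : RMod k (ZAlg k O)}
    (hM : isSheaf (Ltails k O) M) (A : ZAlg k O) :
    Function.Injective ((toInducedCokernel M).hom.app (op A)) := by
  classical
  refine (injective_iff_map_eq_zero ((toInducedCokernel M).hom.app (op A)).hom).2 fun x hx => ?_
  have hx : Sigma.ι (fun j => O (-(genObj M j).deg)) ⟨A, x⟩ ≫ cokernel.π (relations M) = 0 :=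
    hx
  obtain ⟨R, hR, h⟩ := hP (Abelian.factorThruImage (relations M)) inferInstance A
    ((sections _ A).symm (kernel.lift (cokernel.π (relations M)) _ hx))
  refine hM.ext hR fun B g hg => ?_
  obtain ⟨z, hz⟩ := h B g hg
  have hz : sections _ B z ≫ relations M =
      homVal g ≫ Sigma.ι (fun j => O (-(genObj M j).deg)) ⟨A, x⟩ := by
    have := congrArg (fun t => sections _ B t ≫ Abelian.image.ι (relations M)) hz
    simp only [sections_induced_map, sections_map, Category.assoc, Abelian.image.fac,
      LinearEquiv.apply_symm_apply] at this
    rw [this]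
    congr 1
    exact kernel.lift_ι _ _ _
  obtain ⟨N, hN⟩ := exists_toSigma_eq (relObj M) (hO (-B.deg)) (sections _ B z)
  refine hM.ext (tail_mem_Ltails B N) fun D f hf => ?_
  rw [map_zero, map_zero]
  rcases lt_or_ge D.deg N with hD | hD
  · rw [eq_zero_of_mem_tail hD hf, RMod.map_zero_apply]
  obtain ⟨t, ht⟩ := hN D hD (homVal f)
  obtain ⟨c, hc, hc'⟩ := exists_toSigma_comp_relations M D t
  rw [ht, Category.assoc, hz, ← Category.assoc, ← homVal_comp,
    ← toSigma_single (genObj M) D ⟨A, x⟩] at hc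
  -- The relation `c` is the single term `f ≫ g` at the generator `x`, so its value is the
  -- restriction of `x` along `f ≫ g`.
  rw [← toSigma_injective _ _ hc, evalComb_single, RMod.map_comp_apply] at hc'
  exact hc'

/-- Projectivity lifts `y` locally to the coproduct of generators; in high degree the lift is a
formal combination, and its value in `M` is a preimage. The two successive restrictions are combined
by the glueing axiom, hence the assumption that `Ltails k O` is a topology. -/
theorem isTEpi_toInducedCokernel (hO : ∀ n : ℤ, IsFinitelyPresentable.{v} (O n))
    (hT : IsTopology (Ltails k O)) (hP : IsTProjective (toCat k O) (Ltails k O))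
    (M : RMod k (ZAlg k O)) : IsTEpi (Ltails k O) (toInducedCokernel M) := by
  rw [hT.isTEpi_iff]
  intro A y
  obtain ⟨R, hR, h⟩ := hP (cokernel.π (relations M)) inferInstance A y
  refine hT.glueing R _ hR fun {B} g hg => ?_
  rw [← liftSieve_map]
  obtain ⟨z, hz⟩ := h B g hg
  obtain ⟨N, hN⟩ := exists_toSigma_eq (genObj M) (hO (-B.deg)) (sections _ B z)
  refine hT.mem_of_le (tail_mem_Ltails B N) fun D f hf => ?_
  rcases lt_or_ge D.deg N with hD | hD
  · rw [eq_zero_of_mem_tail hD hf]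
    exact Submodule.zero_mem _
  obtain ⟨t, ht⟩ := hN D hD (homVal f)
  refine ⟨evalComb M D t, (sections _ D).injective ?_⟩
  rw [sections_toInducedCokernel, ← toSigma_comp_π, ht, ← hz, sections_map, sections_induced_map,
    Category.assoc]

theorem isZGenerating_of_isAmpleSeq [IsLocallyFinitelyPresentable.{v} C]
    (hO : ∀ n : ℤ, IsFinitelyPresentable.{v} (O n)) (hT : Ltails k O = Ttails k O)
    (hA : IsAmpleSeq O) (hP : IsTProjective (toCat k O) (Ltails k O)) : IsZGenerating k O := by
  have hT' : IsTopology (Ltails k O) := hT ▸ isTopology_generated _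
  unfold IsZGenerating
  rw [← hT]
  have h := isSheaf_induced (k := k) hO hA
  have := full_induced (k := k) hA
  have := faithful_induced (k := k) hA
  refine ⟨h, { essSurj := ⟨fun M => ⟨cokernel (relations M.obj), ⟨?_⟩⟩⟩ }⟩
  let φ : M ⟶ ((isSheaf (Ltails k O)).lift (induced k (toCat k O)) h).obj
    (cokernel (relations M.obj)) := ObjectProperty.homMk (toInducedCokernel M.obj)
  have hinj := injective_toInducedCokernel hO hP M.property
  have : IsIso φ := Sh.isIso_of_bijective φ fun A =>
    ⟨hinj A, surjective_of_isTEpi M.property (h _) _ hinj (isTEpi_toInducedCokernel hO hT' hP M.obj) A⟩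
  exact (asIso φ).symm

end

end ZAlg

theorem corollary3 {k : Type w} [CommRing k]
    {C : Type u} [Category.{v} C] [Abelian C] [Linear k C]
    [IsGrothendieckAbelian.{v} C] [IsLocallyFinitelyPresentable.{v} C]
    (O : ℤ → C) (hO : ∀ n : ℤ, IsFinitelyPresentable.{v} (O n))
    (hT : ZAlg.Ltails k O = ZAlg.Ttails k O) :
    ZAlg.IsZGenerating k O ↔
      (IsAmpleSeq O ∧ LinTop.IsTProjective (ZAlg.toCat k O) (ZAlg.Ltails k O)) := by
  refine ⟨fun h => ⟨h.isAmpleSeq hT, ?_⟩, fun h =>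
    ZAlg.isZGenerating_of_isAmpleSeq hO hT h.1 h.2⟩
  rw [hT]
  exact h.isTProjective (ZAlg.toCat k O) (LinTop.isTopology_generated _)
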